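/- **Theorem 4.1.** For $n\ge 1$ let $X_1,\dots,X_n,Y_1,\dots,Y_n$ be independent random variables, each uniformly distributed on $[0,1]$, and let $I_i=[\min(X_i,Y_i),\max(X_i,Y_i)]$. The random interval graph on $n$ vertices has vertex set $\{1,\dots,n\}$, with two different vertices $i,j$ adjacent if and only if $I_i\cap I_j\neq\emptyset$. Let $v$ be a vertex (it may depend on $n$, but it is not random), let $d(v)$ be its degree, and let $\rho_v=\sqrt{a^2+(1-b)^2}$ be the radius of its interval $I_v=[a,b]$. Then the following hold. 1. For every fixed $x\in[0,1]$: if $x\ge 1/2$, then $$\lim_{n\to\infty}P(d(v)\le xn)=1-(1-x)\frac{\pi}{2},$$ and if $x<1/2$, then $$\lim_{n\to\infty}P(d(v)\le xn)=1-(1-x)\left(\frac{\pi}{2}-2\arccos\frac{1}{\sqrt{2-2x}}\right)-\sqrt{1-2x}.$$ 2. For every $n\ge 1$, the conditional distribution of $d(v)$ given $\rho_v=r$ is the binomial distribution with parameters $n-1$ and $1-r^2$. Consequently, for every $x\in[0,1]$, $$P(d(v)\le xn)=\int P\bigl(\mathrm{Bin}(n-1,1-r^2)\le xn\bigr)\,d\mu(r),$$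 where $\mu$ is the distribution of $\rho_v$. -/

import Mathlib

open MeasureTheory ProbabilityTheory Filter Topology

/-- The interval graph of a family of intervals (sets of reals): two different vertices are
adjacent iff the corresponding intervals have non-empty intersection. -/
def intervalGraph {V : Type*} (I : V → Set ℝ) : SimpleGraph V where
  Adj i j := i ≠ j ∧ (I i ∩ I j).Nonempty
  symm := ⟨fun _ _ h => ⟨h.1.symm, by rw [Set.inter_comm]; exact h.2⟩⟩
  loopless := ⟨fun _ h => h.1 rfl⟩

/-- `X i, Y i` (`i : V`) are `2|V|` jointly independent random variables, all uniformly
distributed on `[0, 1]`. -/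
structure IsUniformSample {Ω V : Type*} [MeasurableSpace Ω] (P : Measure Ω)
    (X Y : V → Ω → ℝ) : Prop where
  measurable_left : ∀ i, Measurable (X i)
  measurable_right : ∀ i, Measurable (Y i)
  uniform_left : ∀ i, pdf.IsUniform (X i) (Set.Icc 0 1) P
  uniform_right : ∀ i, pdf.IsUniform (Y i) (Set.Icc 0 1) P
  indep : iIndepFun (Sum.elim X Y) P

/-- The random interval graph: the interval of the vertex `i` is the closed interval
`Set.uIcc (X i ω) (Y i ω) = [min (X i ω) (Y i ω), max (X i ω) (Y i ω)]`. -/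
def randomIntervalGraph {Ω V : Type*} (X Y : V → Ω → ℝ) (ω : Ω) : SimpleGraph V :=
  intervalGraph fun i => Set.uIcc (X i ω) (Y i ω)

open Classical in
/-- The degree of the vertex `v` in the random interval graph. -/
noncomputable def randomDegree {Ω V : Type*} [Fintype V] (X Y : V → Ω → ℝ) (v : V) (ω : Ω) : ℕ :=
  (randomIntervalGraph X Y ω).degree v

/-- The radius `√(a² + (1 - b)²)` of the interval with endpoints `x` and `z`, where
`a = min x z` and `b = max x z`. -/
noncomputable def intervalRadius (x z : ℝ) : ℝ :=
  √((min x z) ^ 2 + (1 - max x z) ^ 2)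

/-- The edge probability `1 - r²` as an element of `[0, 1]`; it is `1 - r²` itself for every
`r ∈ [0, 1]`, in particular for the radius of any interval contained in `[0, 1]`
(outside this range it is truncated to `[0, 1]`). -/
noncomputable def edgeProb (r : ℝ) : unitInterval :=
  Set.projIcc (0 : ℝ) 1 zero_le_one (1 - r ^ 2)

theorem edgeProb_coe {r : ℝ} (h0 : 0 ≤ r) (h1 : r ≤ 1) : (edgeProb r : ℝ) = 1 - r ^ 2 := by
  have h : 1 - r ^ 2 ∈ Set.Icc (0 : ℝ) 1 := ⟨by nlinarith, by nlinarith⟩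
  rw [edgeProb, Set.projIcc_of_mem _ h]

/-- The kernel `r ↦ Binomial(m, 1 - r²)`. -/
noncomputable def binomialKernel (m : ℕ) : Kernel ℝ ℕ where
  toFun r := binomial m (edgeProb r)
  measurable' := by
    have he : Measurable edgeProb :=
      (continuous_projIcc.comp (by fun_prop : Continuous fun r : ℝ => 1 - r ^ 2)).measurable
    refine Measure.measurable_of_measurable_coe _ fun s _ => ?_
    simp only [binomial_eq_sum_dirac, Measure.finsetSum_apply, Measure.smul_apply, smul_eq_mul]
    refine Finset.measurable_sum _ fun k _ => Measurable.mul_const ?_ _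
    exact ENNReal.measurable_ofReal.comp (by fun_prop)

/-! ### Counting successes in independent trials. -/

section Count

/-! Fix the interval `[a, b]` of `v`. Another random interval misses it exactly when both of its
endpoints lie below `a` or both lie above `b`, which has probability `a² + (1 - b)² = ρ²`. Given the
endpoints of `v`, the other intervals are independent, so the degree counts independent trials with
success probability `1 - ρ²`. This law depends on the endpoints only through `ρ`, which gives the
conditional law given `ρ`; integrating it over the law of `ρ` gives the averaged formula.

For the limit, Chebyshev's inequality makes the binomial probabilities tend to 1 where `1 - ρ² < x`
and to 0 where `1 - ρ² > x`. Equality has probability 0, so dominated convergence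
(`tendsto_integral_binomialKernel`) gives the limit `1 - P(ρ² ≤ s)` with `s = 1 - x`.

The point `(a, 1 - b)` is uniform on the triangle `a, c ≥ 0`, `a + c ≤ 1`, with density 2, so `P(ρ²
≤ s)` is twice the area of the part of the disc of radius `√s` in the triangle. The hypotenuse is at
distance `1/√2` from the origin: for `s ≤ 1/2` that part is a quarter disc, for `s > 1/2` the line
cuts a cap off it. This is the case split at `x = 1/2`. -/

open Classical in
theorem pi_filter_eq {E ι : Type*} [Fintype ι] [MeasurableSpace E] (μ : Measure E)
    [IsProbabilityMeasure μ] {A : Set E} (hA : MeasurableSet A) (s : Finset ι) :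
    (Measure.pi fun _ : ι => μ) {w | Finset.univ.filter (fun k => w k ∈ A) = s} =
      μ A ^ s.card * (1 - μ A) ^ (Fintype.card ι - s.card) := by
  -- Prescribing the set of successes turns the event into a product box.
  have h : {w : ι → E | Finset.univ.filter (fun k => w k ∈ A) = s} =
      Set.univ.pi fun k => if k ∈ s then A else Aᶜ := by
    ext w
    simp only [Set.mem_ofPred_eq, Finset.ext_iff, Finset.mem_filter, Finset.mem_univ, true_and,
      Set.mem_univ_pi]
    refine forall_congr' fun k => ?_
    by_cases hk : k ∈ s <;> simp [hk]
  rw [h, Measure.pi_pi]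
  simp only [apply_ite μ, prob_compl_eq_one_sub hA]
  rw [Finset.prod_ite, Finset.prod_const, Finset.prod_const, Finset.filter_not,
    Finset.filter_mem_eq_inter, Finset.univ_inter, Finset.card_sdiff_of_subset s.subset_univ,
    Finset.card_univ]

open Classical in
theorem measurable_card_filter {E F ι : Type*} [Fintype ι] [MeasurableSpace E] [MeasurableSpace F]
    {f : F → ι → E} (hf : Measurable f) {A : F → Set E}
    (hA : MeasurableSet {q : F × E | q.2 ∈ A q.1}) :
    Measurable fun q => (Finset.univ.filter (fun k => f q k ∈ A q)).card := by
  simp only [Finset.card_filter]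
  refine Finset.measurable_sum _ fun k _ => Measurable.ite ?_ measurable_const measurable_const
  exact (measurable_id.prodMk ((measurable_pi_apply k).comp hf)) hA

open Classical in
/-- The number of successes in independent trials with success probability `p` is binomial. -/
theorem map_card_filter_pi_eq_binomial {E : Type*} [MeasurableSpace E] (μ : Measure E)
    [IsProbabilityMeasure μ] {A : Set E} (hA : MeasurableSet A) (n : ℕ) (p : unitInterval)
    (hp : μ A = ENNReal.ofReal p) :
    (Measure.pi fun _ : Fin n => μ).map
      (fun w => (Finset.univ.filter (fun k => w k ∈ A)).card) = binomial n p := by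
  have hm : Measurable fun w : Fin n → E => (Finset.univ.filter (fun k => w k ∈ A)).card :=
    measurable_card_filter (A := fun _ => A) measurable_id (measurable_snd hA)
  refine Measure.ext_of_singleton fun k => ?_
  rw [binomial_singleton, Measure.map_apply hm (measurableSet_singleton k)]
  have h : (fun w : Fin n → E => (Finset.univ.filter (fun k => w k ∈ A)).card) ⁻¹' {k} =
      ⋃ s ∈ (Finset.univ : Finset (Fin n)).powersetCard k,
        {w | Finset.univ.filter (fun k => w k ∈ A) = s} := by
    ext w
    simp [Finset.mem_powersetCard]
  have hms : ∀ s : Finset (Fin n),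
      MeasurableSet {w : Fin n → E | Finset.univ.filter (fun k => w k ∈ A) = s} := by
    intro s
    have : {w : Fin n → E | Finset.univ.filter (fun k => w k ∈ A) = s} =
        ⋂ k, {w | w k ∈ A ↔ k ∈ s} := by
      ext w
      simp [Finset.ext_iff]
    rw [this]
    refine MeasurableSet.iInter fun k => ?_
    by_cases hk : k ∈ s
    · simp only [hk, iff_true]
      exact measurable_pi_apply k hA
    · simp only [hk, iff_false]
      exact (measurable_pi_apply (X := fun _ : Fin n => E) k) hA.compl
  rw [h, measure_biUnion_finset _ fun s _ => hms s]
  · rw [Finset.sum_congr rfl fun s hs => by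
      rw [pi_filter_eq μ hA s, (Finset.mem_powersetCard.1 hs).2], Finset.sum_const,
      Finset.card_powersetCard, Finset.card_univ, Fintype.card_fin, hp, nsmul_eq_mul,
      ← ENNReal.ofReal_one, ← ENNReal.ofReal_sub _ p.2.1, ← ENNReal.ofReal_pow p.2.1,
      ← ENNReal.ofReal_pow (by linarith [p.2.2]), ← ENNReal.ofReal_mul (pow_nonneg p.2.1 _),
      ← ENNReal.ofReal_natCast, ← ENNReal.ofReal_mul (by positivity), mul_assoc]
  · intro s _ t _ hst
    refine Set.disjoint_left.2 fun w hw hw' => hst ?_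
    rw [← hw, hw']

end Count

/-! ### Conditional laws from independence. -/

section CondDistrib

/-- If `Z` and `W` are independent, `f (Z, W)` has the conditional law `z ↦ law of f (z, W)`. -/
theorem hasCondDistrib_of_hasLaw_prod {Ω E F G : Type*} [MeasurableSpace Ω] [MeasurableSpace E]
    [MeasurableSpace F] [MeasurableSpace G] {P : Measure Ω} {μ : Measure E} {ν : Measure F}
    [IsProbabilityMeasure μ] [IsProbabilityMeasure ν] {Z : Ω → E} {W : Ω → F} (hZ : Measurable Z)
    (hW : Measurable W) (h : P.map (fun ω => (Z ω, W ω)) = μ.prod ν) {f : E × F → G}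
    (hf : Measurable f) (κ : Kernel E G) [IsSFiniteKernel κ]
    (hκ : ∀ᵐ z ∂μ, ν.map (fun w => f (z, w)) = κ z) :
    HasCondDistrib (fun ω => f (Z ω, W ω)) Z κ P := by
  have hZlaw : P.map Z = μ := by
    have := congrArg (Measure.map Prod.fst) h
    rwa [Measure.map_map measurable_fst (hZ.prodMk hW), Measure.map_fst_prod, measure_univ,
      one_smul] at this
  refine ⟨(hZ.prodMk (hf.comp (hZ.prodMk hW))).aemeasurable, ?_⟩
  have hg : Measurable fun q : E × F => (q.1, f q) := measurable_fst.prodMk hf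
  have : (fun ω => (Z ω, f (Z ω, W ω))) = (fun q : E × F => (q.1, f q)) ∘ fun ω => (Z ω, W ω) := rfl
  rw [hZlaw, this, ← Measure.map_map hg (hZ.prodMk hW), h]
  ext s hs
  rw [Measure.map_apply hg hs, Measure.prod_apply (hg hs), Measure.compProd_apply hs]
  refine lintegral_congr_ae ?_
  filter_upwards [hκ] with z hz
  have hfz : Measurable fun w => f (z, w) := hf.comp measurable_prodMk_left
  rw [← hz, Measure.map_apply hfz (measurable_prodMk_left hs)]
  rfl

end CondDistrib

/-! ### Joint law of the endpoints. -/

section Sample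

/-- The uniform distribution on `[0, 1]`. -/
noncomputable abbrev unitUniform : Measure ℝ := volume.restrict (Set.Icc 0 1)

instance isProbabilityMeasure_unitUniform : IsProbabilityMeasure unitUniform :=
  ⟨by simp [unitUniform]⟩

theorem map_eq_unitUniform {Ω : Type*} [MeasurableSpace Ω] {P : Measure Ω} {X : Ω → ℝ}
    (h : pdf.IsUniform X (Set.Icc 0 1) P) : P.map X = unitUniform := by
  rw [pdf.IsUniform] at h
  rw [h, ProbabilityTheory.cond]
  simp [unitUniform]

/-- Joint independence gives a product measure indexed by `V ⊕ V`; measure-preserving equivalences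
regroup its coordinates into one pair per vertex. -/
theorem IsUniformSample.map_endpoints {Ω V : Type*} [Fintype V] [MeasurableSpace Ω] {P : Measure Ω}
    [IsProbabilityMeasure P] {X Y : V → Ω → ℝ} (h : IsUniformSample P X Y) :
    P.map (fun ω i => (X i ω, Y i ω)) =
      Measure.pi fun _ : V => unitUniform.prod unitUniform := by
  have hm : ∀ i, Measurable (Sum.elim X Y i) := by
    rintro (i | i)
    · exact h.measurable_left i
    · exact h.measurable_right i
  have hlaw := (iIndepFun_iff_map_fun_eq_pi_map fun i => (hm i).aemeasurable).1 h.indep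
  have hU : (fun i => P.map (Sum.elim X Y i)) = fun _ : V ⊕ V => unitUniform := by
    funext i
    rcases i with i | i
    · exact map_eq_unitUniform (h.uniform_left i)
    · exact map_eq_unitUniform (h.uniform_right i)
  rw [hU] at hlaw
  have h1 := measurePreserving_sumPiEquivProdPi (fun _ : V ⊕ V => unitUniform)
  have h2 := (measurePreserving_arrowProdEquivProdArrow ℝ ℝ V (fun _ => unitUniform)
    (fun _ => unitUniform)).symm
  have h3 := (h2.comp h1).map_eq
  rw [← hlaw, Measure.map_map (h2.comp h1).measurable (measurable_pi_lambda _ hm)] at h3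
  exact h3

theorem IsUniformSample.map_succAbove {Ω : Type*} [MeasurableSpace Ω] {P : Measure Ω}
    [IsProbabilityMeasure P] {n : ℕ} {X Y : Fin (n + 1) → Ω → ℝ} (h : IsUniformSample P X Y)
    (v : Fin (n + 1)) :
    P.map (fun ω => ((X v ω, Y v ω), fun k => (X (v.succAbove k) ω, Y (v.succAbove k) ω))) =
      (unitUniform.prod unitUniform).prod
        (Measure.pi fun _ : Fin n => unitUniform.prod unitUniform) := by
  have h1 := measurePreserving_piFinSuccAbove
    (fun _ : Fin (n + 1) => unitUniform.prod unitUniform) v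
  have h2 := h1.map_eq
  rw [← h.map_endpoints, Measure.map_map h1.measurable (measurable_pi_lambda _ fun i =>
    (h.measurable_left i).prodMk (h.measurable_right i))] at h2
  exact h2

end Sample

/-! ### The degree as a binomial count. -/

section Degree

/-- The set of (endpoints of) intervals that meet the interval with endpoints `z`. -/
def meetingIntervals (z : ℝ × ℝ) : Set (ℝ × ℝ) :=
  {w | (Set.uIcc z.1 z.2 ∩ Set.uIcc w.1 w.2).Nonempty}

theorem mem_meetingIntervals {z w : ℝ × ℝ} :
    w ∈ meetingIntervals z ↔ min z.1 z.2 ≤ max w.1 w.2 ∧ min w.1 w.2 ≤ max z.1 z.2 := by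
  rw [meetingIntervals, Set.mem_ofPred_eq, Set.uIcc, Set.uIcc, Set.Icc_inter_Icc, Set.nonempty_Icc]
  simp only [sup_le_iff, le_inf_iff]
  have hz : z.1 ⊓ z.2 ≤ z.1 ⊔ z.2 := inf_le_sup
  have hw : w.1 ⊓ w.2 ≤ w.1 ⊔ w.2 := inf_le_sup
  exact ⟨fun h => ⟨h.2.1, h.1.2⟩, fun h => ⟨⟨hz, h.2⟩, h.1, hw⟩⟩

theorem measurableSet_meetingIntervals :
    MeasurableSet {q : (ℝ × ℝ) × ℝ × ℝ | q.2 ∈ meetingIntervals q.1} := by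
  simp only [mem_meetingIntervals]
  refine MeasurableSet.inter (s₁ := {q : (ℝ × ℝ) × ℝ × ℝ | min q.1.1 q.1.2 ≤ max q.2.1 q.2.2})
    (s₂ := {q : (ℝ × ℝ) × ℝ × ℝ | min q.2.1 q.2.2 ≤ max q.1.1 q.1.2}) ?_ ?_ <;>
  exact measurableSet_le (by fun_prop) (by fun_prop)

theorem intervalRadius_sq (x z : ℝ) :
    intervalRadius x z ^ 2 = (min x z) ^ 2 + (1 - max x z) ^ 2 :=
  Real.sq_sqrt (by positivity)

theorem intervalRadius_nonneg (x z : ℝ) : 0 ≤ intervalRadius x z := Real.sqrt_nonneg _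

theorem intervalRadius_le_one {x z : ℝ} (hx : x ∈ Set.Icc (0 : ℝ) 1) (hz : z ∈ Set.Icc (0 : ℝ) 1) :
    intervalRadius x z ≤ 1 := by
  have h0 : 0 ≤ min x z := le_min hx.1 hz.1
  have h1 : max x z ≤ 1 := max_le hx.2 hz.2
  have h2 : min x z ≤ max x z := min_le_max
  refine abs_le_one_iff_mul_self_le_one.2 ?_ |> (le_abs_self _).trans
  rw [← sq, intervalRadius_sq]
  nlinarith

theorem measurable_intervalRadius : Measurable fun z : ℝ × ℝ => intervalRadius z.1 z.2 := by
  unfold intervalRadius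
  fun_prop

/-- The probability that a random interval meets the interval with endpoints `z`. -/
theorem unitUniform_prod_meetingIntervals {z : ℝ × ℝ} (h1 : z.1 ∈ Set.Icc (0 : ℝ) 1)
    (h2 : z.2 ∈ Set.Icc (0 : ℝ) 1) :
    (unitUniform.prod unitUniform) (meetingIntervals z) =
      ENNReal.ofReal (edgeProb (intervalRadius z.1 z.2)) := by
  have ha : 0 ≤ min z.1 z.2 := le_min h1.1 h2.1
  have hb : max z.1 z.2 ≤ 1 := max_le h1.2 h2.2
  have hab : min z.1 z.2 ≤ max z.1 z.2 := min_le_max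
  have hm : MeasurableSet (meetingIntervals z) :=
    measurable_prodMk_left measurableSet_meetingIntervals
  have hc : (meetingIntervals z)ᶜ =
      (Set.Iio (min z.1 z.2) ×ˢ Set.Iio (min z.1 z.2)) ∪
        (Set.Ioi (max z.1 z.2) ×ˢ Set.Ioi (max z.1 z.2)) := by
    ext w
    rw [Set.mem_compl_iff, mem_meetingIntervals, not_and_or, not_le, not_le]
    exact or_congr max_lt_iff lt_min_iff
  have hd : Disjoint (Set.Iio (min z.1 z.2) ×ˢ Set.Iio (min z.1 z.2))
      (Set.Ioi (max z.1 z.2) ×ˢ Set.Ioi (max z.1 z.2)) := by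
    refine Set.disjoint_left.2 fun w hw hw' => ?_
    have e1 : w.1 < min z.1 z.2 := hw.1
    have e2 : max z.1 z.2 < w.1 := hw'.1
    linarith
  have hl : unitUniform (Set.Iio (min z.1 z.2)) = ENNReal.ofReal (min z.1 z.2) := by
    rw [Measure.restrict_apply measurableSet_Iio]
    have : Set.Iio (min z.1 z.2) ∩ Set.Icc 0 1 = Set.Ico 0 (min z.1 z.2) := by
      ext t
      simp only [Set.mem_inter_iff, Set.mem_Iio, Set.mem_Icc, Set.mem_Ico]
      constructor
      · rintro ⟨h, h', -⟩; exact ⟨h', h⟩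
      · rintro ⟨h, h'⟩; exact ⟨h', h, by linarith⟩
    rw [this, Real.volume_Ico, sub_zero]
  have hr : unitUniform (Set.Ioi (max z.1 z.2)) = ENNReal.ofReal (1 - max z.1 z.2) := by
    rw [Measure.restrict_apply measurableSet_Ioi]
    have : Set.Ioi (max z.1 z.2) ∩ Set.Icc 0 1 = Set.Ioc (max z.1 z.2) 1 := by
      ext t
      simp only [Set.mem_inter_iff, Set.mem_Ioi, Set.mem_Icc, Set.mem_Ioc]
      constructor
      · rintro ⟨h, -, h'⟩; exact ⟨h, h'⟩
      · rintro ⟨h, h'⟩; exact ⟨h, by linarith, h'⟩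
    rw [this, Real.volume_Ioc]
  have hcm : (unitUniform.prod unitUniform) (meetingIntervals z)ᶜ =
      ENNReal.ofReal (intervalRadius z.1 z.2 ^ 2) := by
    rw [hc, measure_union hd (measurableSet_Ioi.prod measurableSet_Ioi), Measure.prod_prod,
      Measure.prod_prod, hl, hr, intervalRadius_sq, sq, sq,
      ENNReal.ofReal_add (mul_self_nonneg _) (mul_self_nonneg _), ENNReal.ofReal_mul ha,
      ENNReal.ofReal_mul (by linarith)]
  rw [edgeProb_coe (intervalRadius_nonneg _ _) (intervalRadius_le_one h1 h2),
    ENNReal.ofReal_sub _ (sq_nonneg _), ← hcm, prob_compl_eq_one_sub hm, ENNReal.ofReal_one,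
    ENNReal.sub_sub_cancel ENNReal.one_ne_top prob_le_one]

open Classical in
/-- The number of the intervals `q.2 k` that meet the interval `q.1`. -/
noncomputable def meetingCount (n : ℕ) (q : (ℝ × ℝ) × (Fin n → ℝ × ℝ)) : ℕ :=
  (Finset.univ.filter fun k => q.2 k ∈ meetingIntervals q.1).card

theorem measurable_meetingCount (n : ℕ) : Measurable (meetingCount n) := by
  classical
  have : MeasurableSet {q : ((ℝ × ℝ) × (Fin n → ℝ × ℝ)) × ℝ × ℝ |
      q.2 ∈ meetingIntervals q.1.1} :=
    (by fun_prop : Measurable fun q : ((ℝ × ℝ) × (Fin n → ℝ × ℝ)) × ℝ × ℝ => (q.1.1, q.2))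
      measurableSet_meetingIntervals
  unfold meetingCount
  convert measurable_card_filter (A := fun q => meetingIntervals q.1) measurable_snd this

theorem randomDegree_eq_meetingCount {Ω : Type*} {n : ℕ} (X Y : Fin (n + 1) → Ω → ℝ)
    (v : Fin (n + 1)) (ω : Ω) :
    randomDegree X Y v ω = meetingCount n
      ((X v ω, Y v ω), fun k => (X (v.succAbove k) ω, Y (v.succAbove k) ω)) := by
  classical
  rw [randomDegree, meetingCount, ← SimpleGraph.card_neighborFinset_eq_degree,
    ← Finset.card_map v.succAboveEmb]
  congr 1
  ext j
  simp only [SimpleGraph.mem_neighborFinset, Finset.mem_map, Finset.mem_filter, Finset.mem_univ,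
    true_and, Fin.coe_succAboveEmb]
  constructor
  · rintro ⟨hne, hj⟩
    obtain ⟨k, rfl⟩ := Fin.exists_succAbove_eq hne.symm
    exact ⟨k, hj, rfl⟩
  · rintro ⟨k, hk, rfl⟩
    exact ⟨(Fin.succAbove_ne v k).symm, hk⟩

instance isMarkovKernel_binomialKernel (m : ℕ) : IsMarkovKernel (binomialKernel m) :=
  ⟨fun _ => isProbabilityMeasure_binomial⟩

theorem IsUniformSample.hasCondDistrib_randomDegree {Ω : Type*} [MeasurableSpace Ω] {P : Measure Ω}
    [IsProbabilityMeasure P] {n : ℕ} {X Y : Fin (n + 1) → Ω → ℝ} (h : IsUniformSample P X Y)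
    (v : Fin (n + 1)) :
    HasCondDistrib (randomDegree X Y v) (fun ω => intervalRadius (X v ω) (Y v ω))
      (binomialKernel n) P := by
  have hd : randomDegree X Y v = fun ω => meetingCount n
      ((X v ω, Y v ω), fun k => (X (v.succAbove k) ω, Y (v.succAbove k) ω)) :=
    funext fun ω => randomDegree_eq_meetingCount X Y v ω
  rw [hd]
  -- It suffices to condition on both endpoints, because the resulting law is a function of the
  -- radius alone.
  refine HasCondDistrib.comp_right (hf := measurable_intervalRadius)
    (Z := fun ω => (X v ω, Y v ω)) ?_
  refine hasCondDistrib_of_hasLaw_prod ((h.measurable_left v).prodMk (h.measurable_right v))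
    (measurable_pi_lambda _ fun k => (h.measurable_left _).prodMk (h.measurable_right _))
    (h.map_succAbove v) (measurable_meetingCount n) _ ?_
  have hmem : ∀ᵐ z ∂unitUniform.prod unitUniform,
      z ∈ Set.Icc (0 : ℝ) 1 ×ˢ Set.Icc (0 : ℝ) 1 := by
    rw [Measure.prod_restrict]
    exact ae_restrict_mem (measurableSet_Icc.prod measurableSet_Icc)
  filter_upwards [hmem] with z hz
  exact map_card_filter_pi_eq_binomial _ (measurable_prodMk_left measurableSet_meetingIntervals) n _
    (unitUniform_prod_meetingIntervals hz.1 hz.2)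

theorem IsUniformSample.map_radius {Ω V : Type*} [Fintype V] [MeasurableSpace Ω] {P : Measure Ω}
    [IsProbabilityMeasure P] {X Y : V → Ω → ℝ} (h : IsUniformSample P X Y) (v : V) :
    P.map (fun ω => intervalRadius (X v ω) (Y v ω)) =
      (unitUniform.prod unitUniform).map fun z => intervalRadius z.1 z.2 := by
  have hm : Measurable fun ω i => (X i ω, Y i ω) :=
    measurable_pi_lambda _ fun k => (h.measurable_left _).prodMk (h.measurable_right _)
  rw [← (measurePreserving_eval (fun _ : V => unitUniform.prod unitUniform) v).map_eq,
    ← h.map_endpoints, Measure.map_map (measurable_pi_apply v) hm,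
    Measure.map_map measurable_intervalRadius ((measurable_pi_apply v).comp hm)]
  rfl

/-- The distribution of `Y`, from its conditional distribution given `X`. -/
theorem real_eq_integral_of_hasCondDistrib {Ω E F : Type*} [MeasurableSpace Ω] [MeasurableSpace E]
    [MeasurableSpace F] {P : Measure Ω} [IsProbabilityMeasure P] {X : Ω → E} {Y : Ω → F}
    {κ : Kernel E F} [IsMarkovKernel κ] (h : HasCondDistrib Y X κ P) {s : Set F}
    (hs : MeasurableSet s) : P.real (Y ⁻¹' s) = ∫ x, (κ x).real s ∂(P.map X) := by
  have h1 : P (Y ⁻¹' s) = ∫⁻ x, κ x s ∂(P.map X) := by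
    have := congrArg (fun m => m (Prod.snd ⁻¹' s)) h.map_eq
    rw [Measure.map_apply_of_aemeasurable h.aemeasurable (measurable_snd hs),
      Measure.compProd_apply (measurable_snd hs)] at this
    exact this
  rw [Measure.real, h1]
  exact (integral_toReal (Kernel.measurable_coe κ hs).aemeasurable
    (Eventually.of_forall fun x => measure_lt_top _ _)).symm

end Degree

/-! ### Concentration of the binomial law. -/

section Concentration

/-- The variance of the relative frequency of successes. -/
theorem integral_binomial_sq_sub {n : ℕ} (hn : n ≠ 0) (p : unitInterval) :
    ∫ k, ((p : ℝ) - (k : ℝ) / n) ^ 2 ∂(binomial n p) = (p : ℝ) * (1 - p) / n := by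
  have hI : Finset.Iic n = Finset.range (n + 1) := by
    ext k
    simp
  -- The binomial weights are the Bernstein polynomials at `p`, whose variance identity is the one
  -- needed.
  rw [integral_binomial fun k : ℕ => ((p : ℝ) - (k : ℝ) / n) ^ 2, ← bernstein.variance hn p,
    hI, Finset.sum_range]
  refine Finset.sum_congr rfl fun k _ => ?_
  rw [bernstein_apply, smul_eq_mul, mul_comm]
  rfl

/-- Chebyshev's inequality for the binomial distribution. -/
theorem binomial_real_abs_sub_ge_le {n : ℕ} (hn : n ≠ 0) (p : unitInterval) {ε : ℝ} (hε : 0 < ε) :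
    (binomial n p).real {k : ℕ | ε ≤ |(p : ℝ) - (k : ℝ) / n|} ≤ 1 / ε ^ 2 / n := by
  have h := mul_meas_ge_le_integral_of_nonneg (μ := binomial n p)
    (f := fun k : ℕ => ((p : ℝ) - (k : ℝ) / n) ^ 2)
    (Eventually.of_forall fun k => sq_nonneg _) (integrable_binomial _) (ε ^ 2)
  rw [integral_binomial_sq_sub hn] at h
  have hset : {k : ℕ | ε ≤ |(p : ℝ) - (k : ℝ) / n|} =
      {k : ℕ | ε ^ 2 ≤ ((p : ℝ) - (k : ℝ) / n) ^ 2} := by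
    ext k
    rw [Set.mem_ofPred_eq, Set.mem_ofPred_eq, sq_le_sq, abs_of_pos hε]
  have hn' : (0 : ℝ) < n := by positivity
  have hp : (p : ℝ) * (1 - p) / n ≤ 1 / n := by
    gcongr
    nlinarith [p.2.1, p.2.2]
  rw [hset, div_right_comm, le_div_iff₀ (by positivity), mul_comm]
  exact h.trans hp

theorem tendsto_one_div_sq_div_nat (ε : ℝ) :
    Tendsto (fun n : ℕ => 1 / ε ^ 2 / (n : ℝ)) atTop (𝓝 0) :=
  tendsto_const_div_atTop_nhds_zero_nat _

theorem tendsto_binomial_le_of_lt {p : unitInterval} {x : ℝ} (hx : 0 ≤ x) (hp : (p : ℝ) < x) :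
    Tendsto (fun n : ℕ => (binomial n p).real {k : ℕ | (k : ℝ) ≤ x * ((n + 1 : ℕ) : ℝ)})
      atTop (𝓝 1) := by
  have hlow : ∀ᶠ n : ℕ in atTop, 1 - 1 / (x - p) ^ 2 / (n : ℝ) ≤
      (binomial n p).real {k : ℕ | (k : ℝ) ≤ x * ((n + 1 : ℕ) : ℝ)} := by
    filter_upwards [eventually_ne_atTop 0] with n hn
    have hn' : (0 : ℝ) < n := by positivity
    have h1 := binomial_real_abs_sub_ge_le hn p (sub_pos.2 hp)
    have h2 : (binomial n p).real {k : ℕ | (k : ℝ) ≤ x * ((n + 1 : ℕ) : ℝ)}ᶜ ≤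
        (binomial n p).real {k : ℕ | x - p ≤ |(p : ℝ) - (k : ℝ) / n|} := by
      refine measureReal_mono fun k hk => ?_
      have hk' : x * ((n + 1 : ℕ) : ℝ) < k := not_le.1 hk
      -- There are `n` trials but the threshold is `x * (n + 1)`; as `x ≥ 0`, the surplus only helps
      -- here.
      have : x ≤ (k : ℝ) / n := by
        rw [le_div_iff₀ hn']
        push_cast at hk'
        nlinarith
      rw [Set.mem_ofPred_eq, abs_sub_comm]
      exact le_trans (by linarith) (le_abs_self _)
    rw [probReal_compl_eq_one_sub .of_discrete] at h2
    linarith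
  have h0 : Tendsto (fun n : ℕ => 1 - 1 / (x - p) ^ 2 / (n : ℝ)) atTop (𝓝 1) := by
    simpa using (tendsto_one_div_sq_div_nat (x - p)).const_sub 1
  exact tendsto_of_tendsto_of_tendsto_of_le_of_le' h0 tendsto_const_nhds hlow
    (Eventually.of_forall fun n => measureReal_le_one)

theorem tendsto_binomial_le_of_gt {p : unitInterval} {x : ℝ} (hp : x < p) :
    Tendsto (fun n : ℕ => (binomial n p).real {k : ℕ | (k : ℝ) ≤ x * ((n + 1 : ℕ) : ℝ)})
      atTop (𝓝 0) := by
  -- Half of the gap `p - x` absorbs the surplus `x / n` from the threshold `x * (n + 1)`; the other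
  -- half goes into Chebyshev.
  have hpos : 0 < ((p : ℝ) - x) / 2 := by linarith
  have hx : ∀ᶠ n : ℕ in atTop, x / (n : ℝ) < ((p : ℝ) - x) / 2 :=
    (tendsto_const_div_atTop_nhds_zero_nat x).eventually_lt_const hpos
  have hup : ∀ᶠ n : ℕ in atTop, (binomial n p).real {k : ℕ | (k : ℝ) ≤ x * ((n + 1 : ℕ) : ℝ)} ≤
      1 / (((p : ℝ) - x) / 2) ^ 2 / (n : ℝ) := by
    filter_upwards [eventually_ne_atTop 0, hx] with n hn hxn
    have hn' : (0 : ℝ) < n := by positivity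
    refine le_trans (measureReal_mono fun k hk => ?_) (binomial_real_abs_sub_ge_le hn p hpos)
    have hk' : (k : ℝ) ≤ x * ((n + 1 : ℕ) : ℝ) := hk
    have : (k : ℝ) / n ≤ x + x / n := by
      rw [div_le_iff₀ hn']
      push_cast at hk'
      field_simp
      linarith
    have hgap : ((p : ℝ) - x) / 2 ≤ p - (k : ℝ) / n := by linarith
    exact hgap.trans (le_abs_self _)
  exact tendsto_of_tendsto_of_tendsto_of_le_of_le' tendsto_const_nhds
    (tendsto_one_div_sq_div_nat _) (Eventually.of_forall fun n => measureReal_nonneg) hup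

theorem tendsto_integral_binomialKernel (μ : Measure ℝ) [IsProbabilityMeasure μ] {x : ℝ}
    (hx : 0 ≤ x) (hμ : ∀ᵐ r ∂μ, (edgeProb r : ℝ) ≠ x)
    (hm : MeasurableSet {r | (edgeProb r : ℝ) < x}) :
    Tendsto (fun n : ℕ => ∫ r, (binomialKernel n r).real
      {k : ℕ | (k : ℝ) ≤ x * ((n + 1 : ℕ) : ℝ)} ∂μ)
      atTop (𝓝 (μ.real {r | (edgeProb r : ℝ) < x})) := by
  rw [← integral_indicator_one hm]
  refine tendsto_integral_of_dominated_convergence (fun _ => (1 : ℝ)) (fun n => ?_)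
    (integrable_const _) (fun n => Eventually.of_forall fun r => ?_) ?_
  · exact (Kernel.measurable_coe _ .of_discrete).ennreal_toReal.aestronglyMeasurable
  · rw [Real.norm_of_nonneg measureReal_nonneg]
    exact measureReal_le_one
  · filter_upwards [hμ] with r hr
    rcases lt_or_gt_of_ne hr with h | h
    · rw [Set.indicator_of_mem (show r ∈ {r | (edgeProb r : ℝ) < x} from h)]
      exact tendsto_binomial_le_of_lt hx h
    · rw [Set.indicator_of_notMem (show r ∉ {r | (edgeProb r : ℝ) < x} from not_lt.2 h.le)]
      exact tendsto_binomial_le_of_gt h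

end Concentration

/-! ### Area of the disc within the triangle. -/

section Area

theorem integral_sqrt_sub_sq {s a b : ℝ} (hs : 0 < s) (ha : 0 ≤ a) (hab : a ≤ b) (hb : b ≤ √s) :
    ∫ t in a..b, √(s - t ^ 2) =
      (b * √(s - b ^ 2) + s * Real.arcsin (b / √s)) / 2 -
        (a * √(s - a ^ 2) + s * Real.arcsin (a / √s)) / 2 := by
  have hR : 0 < √s := Real.sqrt_pos.2 hs
  have hRs : √s ^ 2 = s := Real.sq_sqrt hs.le
  have hc : Continuous fun t : ℝ => √(s - t ^ 2) := by fun_prop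
  refine intervalIntegral.integral_eq_sub_of_hasDerivAt_of_le
    (f := fun t => (t * √(s - t ^ 2) + s * Real.arcsin (t / √s)) / 2) hab ?_ (fun t ht => ?_)
    (hc.intervalIntegrable _ _)
  · have : Continuous fun t : ℝ => Real.arcsin (t / √s) :=
      Real.continuous_arcsin.comp (by fun_prop)
    exact (((continuous_id.mul hc).add (continuous_const.mul this)).div_const 2).continuousOn
  · have ht0 : 0 < t := ha.trans_lt ht.1
    have htR : t < √s := ht.2.trans_le hb
    have hpos : 0 < s - t ^ 2 := by nlinarith
    have hq : √(s - t ^ 2) ^ 2 = s - t ^ 2 := Real.sq_sqrt hpos.le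
    have hqpos : 0 < √(s - t ^ 2) := Real.sqrt_pos.2 hpos
    have h1 : HasDerivAt (fun t : ℝ => √(s - t ^ 2)) (-(2 * t) / (2 * √(s - t ^ 2))) t := by
      have := ((hasDerivAt_pow 2 t).const_sub s).sqrt hpos.ne'
      simpa using this
    have hlt : t / √s < 1 := (div_lt_one hR).2 htR
    have hgt : 0 < t / √s := by positivity
    have h2 : HasDerivAt (fun t : ℝ => Real.arcsin (t / √s))
        (1 / √(1 - (t / √s) ^ 2) * (1 / √s)) t :=
      HasDerivAt.comp (h₂ := Real.arcsin) (h := fun t => t / √s) t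
        (Real.hasDerivAt_arcsin (by linarith) hlt.ne) ((hasDerivAt_id t).div_const _)
    have h3 : √(1 - (t / √s) ^ 2) = √(s - t ^ 2) / √s := by
      rw [← Real.sqrt_div hpos.le, div_pow, hRs]
      congr 1
      field_simp
    rw [h3] at h2
    refine ((((hasDerivAt_id t).mul h1).add (h2.const_mul s)).div_const 2).congr_deriv ?_
    simp only [id]
    field_simp
    rw [hq]
    ring

/-- The length of a vertical section of the part of the disc `a ^ 2 + c ^ 2 ≤ s` in the triangle
`0 ≤ a`, `0 ≤ c`, `a + c ≤ 1`. -/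
noncomputable def sectionLength (s a : ℝ) : ℝ := min (1 - a) (√(s - a ^ 2))

theorem continuous_sectionLength (s : ℝ) : Continuous (sectionLength s) := by
  unfold sectionLength
  fun_prop

theorem sectionLength_nonneg {s a : ℝ} (ha : a ≤ 1) : 0 ≤ sectionLength s a :=
  le_min (by linarith) (Real.sqrt_nonneg _)

theorem integral_sqrt_sub_sq_tail {s b : ℝ} (hs0 : 0 < s) (hs1 : s ≤ 1) (hb0 : 0 ≤ b)
    (hb : b ≤ √s) :
    ∫ t in b..1, √(s - t ^ 2) =
      s * (Real.pi / 4) - (b * √(s - b ^ 2) + s * Real.arcsin (b / √s)) / 2 := by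
  have hc : Continuous fun t : ℝ => √(s - t ^ 2) := by fun_prop
  have hR1 : √s ≤ 1 := Real.sqrt_le_one.2 hs1
  -- Beyond the radius the radicand is negative, and `Real.sqrt` returns 0 there.
  have hz : ∫ t in √s..1, √(s - t ^ 2) = 0 := by
    refine intervalIntegral.integral_zero_ae (Eventually.of_forall fun t ht => ?_)
    rw [Set.uIoc_of_le hR1] at ht
    refine Real.sqrt_eq_zero_of_nonpos ?_
    have := Real.sq_sqrt hs0.le
    nlinarith [ht.1, Real.sqrt_nonneg s]
  rw [← intervalIntegral.integral_add_adjacent_intervals (b := √s) (hc.intervalIntegrable _ _)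
    (hc.intervalIntegrable _ _), hz, integral_sqrt_sub_sq hs0 hb0 hb le_rfl, Real.sq_sqrt hs0.le,
    div_self (Real.sqrt_pos.2 hs0).ne', Real.arcsin_one, sub_self, Real.sqrt_zero]
  ring

theorem integral_sectionLength_of_le_half {s : ℝ} (hs0 : 0 ≤ s) (hs : s ≤ 1 / 2) :
    ∫ a in (0 : ℝ)..1, sectionLength s a = s * (Real.pi / 4) := by
  have h : ∫ a in (0 : ℝ)..1, sectionLength s a = ∫ a in (0 : ℝ)..1, √(s - a ^ 2) := by
    refine intervalIntegral.integral_congr fun a ha => ?_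
    rw [Set.uIcc_of_le zero_le_one] at ha
    refine min_eq_right (Real.sqrt_le_iff.2 ⟨by linarith [ha.2], ?_⟩)
    nlinarith [sq_nonneg (a - 1 / 2)]
  rw [h]
  rcases hs0.eq_or_lt with rfl | hs0
  · rw [zero_mul]
    refine intervalIntegral.integral_zero_ae (Eventually.of_forall fun t _ => ?_)
    exact Real.sqrt_eq_zero_of_nonpos (by nlinarith)
  · rw [integral_sqrt_sub_sq_tail hs0 (by linarith) le_rfl (Real.sqrt_nonneg s)]
    simp

/-- The line `a + c = 1` meets the circle at `a = (1 ± d) / 2` with `d = √(2 * s - 1)`. Between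
these abscissas the line is the lower boundary, outside them the circle is. -/
theorem integral_sectionLength_of_half_lt {s : ℝ} (hs : 1 / 2 < s) (hs1 : s ≤ 1) :
    ∫ a in (0 : ℝ)..1, sectionLength s a =
      (s * (Real.pi / 2 - 2 * Real.arccos (1 / √(2 * s))) + √(2 * s - 1)) / 2 := by
  have hs0 : 0 < s := by linarith
  set d := √(2 * s - 1) with hd
  have hd2 : d ^ 2 = 2 * s - 1 := Real.sq_sqrt (by linarith)
  have hd0 : 0 ≤ d := Real.sqrt_nonneg _
  have hd1 : d ≤ 1 := Real.sqrt_le_one.2 (by linarith)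
  set R := √s with hR
  have hR0 : 0 < R := Real.sqrt_pos.2 hs0
  have hR2 : R ^ 2 = s := Real.sq_sqrt hs0.le
  have hcs : Continuous fun t : ℝ => √(s - t ^ 2) := by fun_prop
  have hch := continuous_sectionLength s
  have e1 : √(s - ((1 - d) / 2) ^ 2) = (1 + d) / 2 := by
    rw [Real.sqrt_eq_iff_mul_self_eq (by nlinarith) (by linarith)]
    nlinarith
  have e2 : √(s - ((1 + d) / 2) ^ 2) = (1 - d) / 2 := by
    rw [Real.sqrt_eq_iff_mul_self_eq (by nlinarith) (by linarith)]
    nlinarith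
  have hbR : (1 + d) / 2 ≤ R := Real.le_sqrt_of_sq_le (by nlinarith)
  have i1 : ∫ a in (0 : ℝ)..(1 - d) / 2, sectionLength s a =
      ∫ a in (0 : ℝ)..(1 - d) / 2, √(s - a ^ 2) := by
    refine intervalIntegral.integral_congr fun a ha => ?_
    rw [Set.uIcc_of_le (by linarith)] at ha
    refine min_eq_right (Real.sqrt_le_iff.2 ⟨by linarith [ha.2], ?_⟩)
    nlinarith [mul_nonneg (sub_nonneg.2 ha.2) (by linarith [ha.2] : 0 ≤ (1 + d) / 2 - a)]
  have i2 : ∫ a in (1 - d) / 2..(1 + d) / 2, sectionLength s a =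
      ∫ a in (1 - d) / 2..(1 + d) / 2, (1 - a) := by
    refine intervalIntegral.integral_congr fun a ha => ?_
    rw [Set.uIcc_of_le (by linarith)] at ha
    refine min_eq_left (Real.le_sqrt_of_sq_le ?_)
    nlinarith [mul_nonneg (sub_nonneg.2 ha.1) (sub_nonneg.2 ha.2)]
  have i3 : ∫ a in (1 + d) / 2..1, sectionLength s a =
      ∫ a in (1 + d) / 2..1, √(s - a ^ 2) := by
    refine intervalIntegral.integral_congr fun a ha => ?_
    rw [Set.uIcc_of_le (by linarith)] at ha
    refine min_eq_right (Real.sqrt_le_iff.2 ⟨by linarith [ha.2], ?_⟩)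
    nlinarith [mul_nonneg (sub_nonneg.2 ha.1) (by linarith [ha.1] : 0 ≤ a - (1 - d) / 2)]
  have i2' : ∫ a in (1 - d) / 2..(1 + d) / 2, (1 - a) = d / 2 := by
    rw [intervalIntegral.integral_sub (by simp) (by simp)]
    simp only [intervalIntegral.integral_const, integral_id, smul_eq_mul]
    ring
  -- `θ` is half the angle subtended at the origin by the chord; the chord's endpoints have polar
  -- angles `π / 4 ± θ`.
  set θ := Real.arccos (1 / √(2 * s)) with hθ
  have hq : √(2 * s) = √2 * R := Real.sqrt_mul (by norm_num) s
  have h2 : √(2 : ℝ) ^ 2 = 2 := Real.sq_sqrt (by norm_num)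
  have h20 : 0 < √(2 : ℝ) := by positivity
  have hle : 1 / √(2 * s) ≤ 1 := by
    rw [div_le_one (by positivity)]
    exact Real.one_le_sqrt.2 (by linarith)
  have hcosθ : Real.cos θ = 1 / (√2 * R) := by
    rw [hθ, Real.cos_arccos (le_trans (by norm_num) (by positivity : 0 ≤ 1 / √(2 * s))) hle, hq]
  have hsinθ : Real.sin θ = d / (√2 * R) := by
    rw [hθ, Real.sin_arccos, hd, ← hq, ← Real.sqrt_div (by linarith), div_pow,
      Real.sq_sqrt (by linarith)]
    congr 1
    field_simp
  have hθ0 : 0 ≤ θ := Real.arccos_nonneg _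
  -- This keeps `π / 4 ± θ` in the range where `arcsin` inverts `sin`.
  have hθ4 : θ ≤ Real.pi / 4 := by
    rw [← Real.arccos_cos (x := Real.pi / 4) (by positivity) (by linarith [Real.pi_pos]), hθ]
    refine Real.arccos_le_arccos ?_
    rw [Real.cos_pi_div_four, hq, div_le_div_iff₀ (by norm_num) (by positivity)]
    have : R ≤ 1 := Real.sqrt_le_one.2 hs1
    nlinarith
  have a1 : Real.arcsin ((1 - d) / 2 / R) = Real.pi / 4 - θ := by
    rw [← Real.arcsin_sin (x := Real.pi / 4 - θ) (by linarith [Real.pi_pos])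
      (by linarith [Real.pi_pos]), Real.sin_sub, Real.sin_pi_div_four, Real.cos_pi_div_four, hcosθ,
      hsinθ]
    congr 1
    field_simp
  have a2 : Real.arcsin ((1 + d) / 2 / R) = Real.pi / 4 + θ := by
    rw [← Real.arcsin_sin (x := Real.pi / 4 + θ) (by linarith [Real.pi_pos])
      (by linarith [Real.pi_pos]), Real.sin_add, Real.sin_pi_div_four, Real.cos_pi_div_four, hcosθ,
      hsinθ]
    congr 1
    field_simp
  rw [← intervalIntegral.integral_add_adjacent_intervals (b := (1 + d) / 2)
      (hch.intervalIntegrable _ _) (hch.intervalIntegrable _ _),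
    ← intervalIntegral.integral_add_adjacent_intervals (a := 0) (b := (1 - d) / 2)
      (hch.intervalIntegrable _ _) (hch.intervalIntegrable _ _), i1, i2, i3, i2',
    integral_sqrt_sub_sq hs0 le_rfl (by linarith) (by linarith),
    integral_sqrt_sub_sq_tail hs0 hs1 (by linarith) hbR, e1, e2, a1, a2]
  simp only [zero_mul, zero_div, Real.arcsin_zero, mul_zero, add_zero, sub_zero]
  ring

theorem volume_upper_section {s x : ℝ} (hx : x ∈ Set.Icc (0 : ℝ) 1) :
    volume {y | y ∈ Set.Ioc x 1 ∧ x ^ 2 + (1 - y) ^ 2 ≤ s} =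
      ENNReal.ofReal (sectionLength s x) := by
  rcases lt_or_ge (s - x ^ 2) 0 with h | h
  · have : {y | y ∈ Set.Ioc x 1 ∧ x ^ 2 + (1 - y) ^ 2 ≤ s} = ∅ := by
      ext y
      simp only [Set.mem_ofPred_eq, Set.mem_empty_iff_false, iff_false, not_and]
      intro _
      nlinarith [sq_nonneg (1 - y)]
    rw [this, sectionLength, Real.sqrt_eq_zero_of_nonpos h.le, min_eq_right (by linarith [hx.2])]
    simp
  · have key : ∀ y, y ≤ 1 → (x ^ 2 + (1 - y) ^ 2 ≤ s ↔ 1 - √(s - x ^ 2) ≤ y) := by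
      intro y hy
      rw [sub_le_comm, Real.le_sqrt (sub_nonneg.2 hy) h, le_sub_iff_add_le']
    rcases le_or_gt (1 - √(s - x ^ 2)) x with h' | h'
    · have : {y | y ∈ Set.Ioc x 1 ∧ x ^ 2 + (1 - y) ^ 2 ≤ s} = Set.Ioc x 1 := by
        ext y
        refine ⟨fun hy => hy.1, fun hy => ⟨hy, (key y hy.2).2 (h'.trans hy.1.le)⟩⟩
      rw [this, Real.volume_Ioc, sectionLength, min_eq_left (by linarith)]
    · have : {y | y ∈ Set.Ioc x 1 ∧ x ^ 2 + (1 - y) ^ 2 ≤ s} =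
          Set.Icc (1 - √(s - x ^ 2)) 1 := by
        ext y
        exact ⟨fun hy => ⟨(key y hy.1.2).1 hy.2, hy.1.2⟩,
          fun hy => ⟨⟨h'.trans_le hy.1, hy.2⟩, (key y hy.2).2 hy.1⟩⟩
      rw [this, Real.volume_Icc, sectionLength, min_eq_right (by linarith), sub_sub_cancel]

/-- When `x` is the larger endpoint, the fixed coordinate of `(a, 1 - b)` is `1 - x`, so the section
is taken at `1 - x`. -/
theorem volume_lower_section {s x : ℝ} (hx : x ∈ Set.Icc (0 : ℝ) 1) :
    volume {y | y ∈ Set.Icc 0 x ∧ y ^ 2 + (1 - x) ^ 2 ≤ s} =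
      ENNReal.ofReal (sectionLength s (1 - x)) := by
  rcases lt_or_ge (s - (1 - x) ^ 2) 0 with h | h
  · have : {y | y ∈ Set.Icc 0 x ∧ y ^ 2 + (1 - x) ^ 2 ≤ s} = ∅ := by
      ext y
      simp only [Set.mem_ofPred_eq, Set.mem_empty_iff_false, iff_false, not_and]
      intro _
      nlinarith [sq_nonneg y]
    rw [this, sectionLength, Real.sqrt_eq_zero_of_nonpos h.le, min_eq_right (by linarith [hx.1])]
    simp
  · have : {y | y ∈ Set.Icc 0 x ∧ y ^ 2 + (1 - x) ^ 2 ≤ s} =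
        Set.Icc 0 (min x √(s - (1 - x) ^ 2)) := by
      ext y
      simp only [Set.mem_ofPred_eq, Set.mem_Icc, le_min_iff, and_assoc]
      refine and_congr_right fun hy => and_congr_right fun _ => ?_
      rw [Real.le_sqrt hy h, le_sub_iff_add_le]
    rw [this, Real.volume_Icc, sectionLength, sub_sub_cancel, sub_zero]

theorem unitUniform_section {s x : ℝ} (hx : x ∈ Set.Icc (0 : ℝ) 1) :
    unitUniform {y | intervalRadius x y ^ 2 ≤ s} =
      ENNReal.ofReal (sectionLength s x + sectionLength s (1 - x)) := by
  have hm : MeasurableSet {y | intervalRadius x y ^ 2 ≤ s} := by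
    simp only [intervalRadius_sq]
    exact measurableSet_le (by fun_prop) (by fun_prop)
  have h : {y | intervalRadius x y ^ 2 ≤ s} ∩ Set.Icc 0 1 =
      {y | y ∈ Set.Ioc x 1 ∧ x ^ 2 + (1 - y) ^ 2 ≤ s} ∪
        {y | y ∈ Set.Icc 0 x ∧ y ^ 2 + (1 - x) ^ 2 ≤ s} := by
    ext y
    simp only [intervalRadius_sq, Set.mem_inter_iff, Set.mem_union, Set.mem_ofPred_eq, Set.mem_Icc,
      Set.mem_Ioc]
    rcases lt_or_ge x y with hxy | hxy
    · rw [min_eq_left hxy.le, max_eq_right hxy.le]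
      have : 0 ≤ y := hx.1.trans hxy.le
      have h' : ¬ y ≤ x := not_le.2 hxy
      tauto
    · rw [min_eq_right hxy, max_eq_left hxy]
      have : y ≤ 1 := hxy.trans hx.2
      have h' : ¬ x < y := not_lt.2 hxy
      tauto
  have hd : Disjoint {y | y ∈ Set.Ioc x 1 ∧ x ^ 2 + (1 - y) ^ 2 ≤ s}
        {y | y ∈ Set.Icc 0 x ∧ y ^ 2 + (1 - x) ^ 2 ≤ s} :=
    Set.disjoint_left.2 fun y hy hy' => absurd hy'.1.2 (not_le.2 hy.1.1)
  have hm2 : MeasurableSet {y | y ∈ Set.Icc 0 x ∧ y ^ 2 + (1 - x) ^ 2 ≤ s} :=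
    measurableSet_Icc.inter (s₂ := {y | y ^ 2 + (1 - x) ^ 2 ≤ s})
      (measurableSet_le (by fun_prop) measurable_const)
  rw [Measure.restrict_apply hm, h, measure_union hd hm2, volume_upper_section hx,
    volume_lower_section hx, ENNReal.ofReal_add (sectionLength_nonneg hx.2)
      (sectionLength_nonneg (by linarith [hx.1]))]

theorem measurableSet_radius_sq_le (s : ℝ) :
    MeasurableSet {z : ℝ × ℝ | intervalRadius z.1 z.2 ^ 2 ≤ s} :=
  measurableSet_le (measurable_intervalRadius.pow_const 2) measurable_const

/-- The distribution function of the squared radius of a random interval. -/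
theorem unitUniform_prod_radius_sq_le (s : ℝ) :
    (unitUniform.prod unitUniform).real {z | intervalRadius z.1 z.2 ^ 2 ≤ s} =
      2 * ∫ a in (0 : ℝ)..1, sectionLength s a := by
  have hc := continuous_sectionLength s
  have hc' : Continuous fun x => sectionLength s (1 - x) := hc.comp (by fun_prop)
  rw [Measure.real, Measure.prod_apply (measurableSet_radius_sq_le s)]
  have h : ∫⁻ x, unitUniform (Prod.mk x ⁻¹' {z : ℝ × ℝ | intervalRadius z.1 z.2 ^ 2 ≤ s})
      ∂unitUniform =
      ∫⁻ x in Set.Icc 0 1, ENNReal.ofReal (sectionLength s x + sectionLength s (1 - x)) :=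
    setLIntegral_congr_fun measurableSet_Icc fun x hx => unitUniform_section hx
  -- The substitution `x ↦ 1 - x` makes both terms equal, whence the factor 2.
  rw [h, ← ofReal_integral_eq_lintegral_ofReal, ENNReal.toReal_ofReal,
    integral_Icc_eq_integral_Ioc, ← intervalIntegral.integral_of_le zero_le_one,
    intervalIntegral.integral_add (hc.intervalIntegrable _ _) (hc'.intervalIntegrable _ _),
    intervalIntegral.integral_comp_sub_left (fun x => sectionLength s x)]
  · simp only [sub_self, sub_zero]
    ring
  · exact setIntegral_nonneg measurableSet_Icc fun x hx =>
      add_nonneg (sectionLength_nonneg hx.2) (sectionLength_nonneg (by linarith [hx.1]))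
  · exact (hc.add hc').continuousOn.integrableOn_Icc
  · filter_upwards [ae_restrict_mem measurableSet_Icc] with x hx
    exact add_nonneg (sectionLength_nonneg hx.2) (sectionLength_nonneg (by linarith [hx.1]))

theorem ae_radius_sq_ne (s : ℝ) :
    ∀ᵐ z ∂unitUniform.prod unitUniform, intervalRadius z.1 z.2 ^ 2 ≠ s := by
  have hm : MeasurableSet {z : ℝ × ℝ | ¬ intervalRadius z.1 z.2 ^ 2 ≠ s} := by
    simp only [not_not]
    exact measurable_intervalRadius.pow_const 2 (measurableSet_singleton s)
  rw [ae_iff, Measure.measure_prod_null hm]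
  refine Eventually.of_forall fun x => ?_
  -- For fixed `x` the level set lies in the solutions of two quadratics in `y`, one for each order
  -- of the endpoints.
  refine Set.Finite.measure_zero (Set.Finite.subset
    (s := {1 + √(s - x ^ 2), 1 - √(s - x ^ 2), √(s - (1 - x) ^ 2), -√(s - (1 - x) ^ 2)})
    (by simp) fun y hy => ?_) _
  have hy : intervalRadius x y ^ 2 = s := not_not.1 hy
  rw [intervalRadius_sq] at hy
  simp only [Set.mem_insert_iff, Set.mem_singleton_iff]
  rcases le_total x y with hxy | hxy
  · rw [min_eq_left hxy, max_eq_right hxy] at hy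
    rw [← hy, add_sub_cancel_left, Real.sqrt_sq_eq_abs]
    rcases abs_choice (1 - y) with h | h <;> rw [h]
    · right; left; ring
    · left; ring
  · rw [min_eq_right hxy, max_eq_left hxy] at hy
    rw [← hy, add_sub_cancel_right, Real.sqrt_sq_eq_abs]
    rcases abs_choice y with h | h <;> rw [h]
    · right; right; left; rfl
    · right; right; right; ring

end Area

/-! ### Passage to the limit. -/

section Limit

theorem measurable_edgeProb : Measurable edgeProb :=
  (continuous_projIcc.comp (by fun_prop : Continuous fun r : ℝ => 1 - r ^ 2)).measurable

theorem measurableSet_edgeProb_lt (x : ℝ) : MeasurableSet {r | (edgeProb r : ℝ) < x} :=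
  measurableSet_lt measurable_edgeProb.subtype_val measurable_const

/-- Sampled endpoints lie in `[0, 1]` almost surely, so the truncation in `edgeProb` is inactive. -/
theorem ae_edgeProb_radius :
    ∀ᵐ z ∂unitUniform.prod unitUniform,
      (edgeProb (intervalRadius z.1 z.2) : ℝ) = 1 - intervalRadius z.1 z.2 ^ 2 := by
  rw [Measure.prod_restrict]
  filter_upwards [ae_restrict_mem (measurableSet_Icc.prod measurableSet_Icc)] with z hz
  exact edgeProb_coe (intervalRadius_nonneg _ _) (intervalRadius_le_one hz.1 hz.2)

theorem map_radius_edgeProb_lt (x : ℝ) :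
    ((unitUniform.prod unitUniform).map fun z => intervalRadius z.1 z.2).real
      {r | (edgeProb r : ℝ) < x} = 1 - 2 * ∫ a in (0 : ℝ)..1, sectionLength (1 - x) a := by
  rw [map_measureReal_apply measurable_intervalRadius (measurableSet_edgeProb_lt x),
    ← unitUniform_prod_radius_sq_le, ← probReal_compl_eq_one_sub (measurableSet_radius_sq_le _)]
  refine measureReal_congr ?_
  filter_upwards [ae_edgeProb_radius] with z hz
  refine propext ?_
  change (edgeProb (intervalRadius z.1 z.2) : ℝ) < x ↔ ¬ intervalRadius z.1 z.2 ^ 2 ≤ 1 - x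
  rw [hz, not_le, sub_lt_comm]

theorem ae_map_radius_edgeProb_ne (x : ℝ) :
    ∀ᵐ r ∂(unitUniform.prod unitUniform).map fun z => intervalRadius z.1 z.2,
      (edgeProb r : ℝ) ≠ x := by
  have hm : MeasurableSet {r | (edgeProb r : ℝ) ≠ x} :=
    (measurable_edgeProb.subtype_val (measurableSet_singleton x)).compl
  rw [ae_map_iff measurable_intervalRadius.aemeasurable hm]
  filter_upwards [ae_edgeProb_radius, ae_radius_sq_ne (1 - x)] with z hz hz' h
  exact hz' (by linarith)

theorem IsUniformSample.real_randomDegree_le {Ω : Type*} [MeasurableSpace Ω] {P : Measure Ω}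
    [IsProbabilityMeasure P] {n : ℕ} {X Y : Fin (n + 1) → Ω → ℝ} (h : IsUniformSample P X Y)
    (v : Fin (n + 1)) (c : ℝ) :
    P.real {ω | (randomDegree X Y v ω : ℝ) ≤ c} =
      ∫ r, (binomialKernel n r).real {k : ℕ | (k : ℝ) ≤ c}
        ∂(P.map fun ω => intervalRadius (X v ω) (Y v ω)) :=
  real_eq_integral_of_hasCondDistrib (h.hasCondDistrib_randomDegree v)
    (s := {k : ℕ | (k : ℝ) ≤ c}) .of_discrete

theorem tendsto_real_randomDegree_le {Ω : ℕ → Type*} [∀ n, MeasurableSpace (Ω n)]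
    (P : ∀ n, Measure (Ω n)) [∀ n, IsProbabilityMeasure (P n)]
    (X Y : ∀ n, Fin (n + 1) → Ω n → ℝ) (hXY : ∀ n, IsUniformSample (P n) (X n) (Y n))
    (v : ∀ n, Fin (n + 1)) {x : ℝ} (hx : 0 ≤ x) :
    Tendsto (fun n : ℕ => (P n).real
        {ω | (randomDegree (X n) (Y n) (v n) ω : ℝ) ≤ x * ((n + 1 : ℕ) : ℝ)})
      atTop (𝓝 (1 - 2 * ∫ a in (0 : ℝ)..1, sectionLength (1 - x) a)) := by
  have := Measure.isProbabilityMeasure_map (μ := unitUniform.prod unitUniform)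
    measurable_intervalRadius.aemeasurable
  have h := tendsto_integral_binomialKernel
    ((unitUniform.prod unitUniform).map fun z => intervalRadius z.1 z.2) hx
    (ae_map_radius_edgeProb_ne x) (measurableSet_edgeProb_lt x)
  rw [map_radius_edgeProb_lt] at h
  refine h.congr fun n => ?_
  rw [(hXY n).real_randomDegree_le, (hXY n).map_radius]

end Limit

/-- The `n`-th random interval graph has the `n + 1` vertices `Fin (n + 1)`, so that every positive
number of vertices occurs and a vertex exists. -/
theorem theorem4p1 {Ω : ℕ → Type*} [∀ n, MeasurableSpace (Ω n)]
    (P : ∀ n, Measure (Ω n)) [∀ n, IsProbabilityMeasure (P n)]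
    (X Y : ∀ n, Fin (n + 1) → Ω n → ℝ)
    (hXY : ∀ n, IsUniformSample (P n) (X n) (Y n))
    (v : ∀ n, Fin (n + 1)) :
    -- limiting distribution of the degree
    (∀ x ∈ Set.Icc (0 : ℝ) 1,
      (1 / 2 ≤ x →
        Tendsto
          (fun n : ℕ => (P n).real
            {ω | (randomDegree (X n) (Y n) (v n) ω : ℝ) ≤ x * ((n + 1 : ℕ) : ℝ)})
          atTop (𝓝 (1 - (1 - x) * (Real.pi / 2)))) ∧
      (x < 1 / 2 →
        Tendsto
          (fun n : ℕ => (P n).real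
            {ω | (randomDegree (X n) (Y n) (v n) ω : ℝ) ≤ x * ((n + 1 : ℕ) : ℝ)})
          atTop
          (𝓝 (1 - (1 - x) * (Real.pi / 2 - 2 * Real.arccos (1 / √(2 - 2 * x)))
            - √(1 - 2 * x))))) ∧
    -- given the radius `r` of the interval of `v`, the degree is `Binomial(n, 1 - r²)`
    (∀ n, HasCondDistrib (randomDegree (X n) (Y n) (v n))
      (fun ω => intervalRadius (X n (v n) ω) (Y n (v n) ω)) (binomialKernel n) (P n)) ∧
    -- averaging over the law of the radius
    (∀ n, ∀ x ∈ Set.Icc (0 : ℝ) 1,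
      (P n).real {ω | (randomDegree (X n) (Y n) (v n) ω : ℝ) ≤ x * ((n + 1 : ℕ) : ℝ)} =
        ∫ r, (binomialKernel n r).real {k : ℕ | (k : ℝ) ≤ x * ((n + 1 : ℕ) : ℝ)}
          ∂((P n).map fun ω => intervalRadius (X n (v n) ω) (Y n (v n) ω))) := by
  refine ⟨fun x hx => ⟨fun hx2 => ?_, fun hx2 => ?_⟩,
    fun n => (hXY n).hasCondDistrib_randomDegree (v n),
    fun n x _ => (hXY n).real_randomDegree_le (v n) _⟩
  · convert tendsto_real_randomDegree_le P X Y hXY v hx.1 using 2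
    rw [integral_sectionLength_of_le_half (by linarith [hx.2]) (by linarith)]
    ring
  · convert tendsto_real_randomDegree_le P X Y hXY v hx.1 using 2
    rw [integral_sectionLength_of_half_lt (by linarith) (by linarith [hx.1]),
      show 2 * (1 - x) = 2 - 2 * x by ring, show 2 - 2 * x - 1 = 1 - 2 * x by ring]
    ring
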